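/- Let $d\ge 2$ be an integer. An uncertain point with $k$ locations is a family $p_i=(p_{i,1},\dots,p_{i,k})$ of points of $\mathbb{R}^d$; its random location $q_i$ equals $p_{i,j}$ with probability $1/k$ for each $j\in\{1,\dots,k\}$. Let $P=\{p_1,\dots,p_n\}$ be a nonempty finite set of uncertain points with $k$ locations each, whose random locations are independent. For $r\subseteq\mathbb{R}^d$ and a nonempty subset $T\subseteq P$ write $$E_{r(T)}=\mathbf{E}\!\left[\frac{|\{i : p_i\in T,\ q_i\in r\}|}{|T|}\right].$$ A nonempty subset $T\subseteq P$ is an $\varepsilon$-RE coreset of $P$ for axis-aligned rectangles if $|E_{r(P)}-E_{r(T)}|\le\varepsilon$ for every axis-aligned rectangle $r=I_1\times\dots\times I_d$, where each $I_j\subseteq\mathbb{R}$ is an interval (of any kind). Theorem. There is a constant $C=C(d)>0$ such that for all integers $k\ge 1$, all $\varepsilon\in(0,1]$ with $k/\varepsilon\ge 2$, all $n\ge 1$, and every set $P$ of $n$ uncertain points in $\mathbb{R}^d$ with $k$ locations each, there is an $\varepsilon$-RE coreset $T\subseteq P$ of $P$ for axis-aligned rectangles with $$|T|\le C\,\frac{\sqrt{k}}{\varepsilon}\,\Bigl(\log\frac{k}{\varepsilon}\Bigr)^{(3d-1)/2}.$$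 -/

import Mathlib

open MeasureTheory ProbabilityTheory

namespace UncertainPoints

/-- The law of an uncertain point with the `k` possible locations `p 0, …, p (k - 1)` in `ℝ^d`:
each location is taken with probability `1 / k`. -/
noncomputable def locationLaw {d k : ℕ} (p : Fin k → (Fin d → ℝ)) : Measure (Fin d → ℝ) :=
  (uniformOn (Set.univ : Set (Fin k))).map p

/-- The law of a random transversal `Q = (q i)` of a finite family `P` of uncertain points:
the locations `q i` are independent, and `q i` has the law of the uncertain point `P i`. -/
noncomputable def transversalLaw {d k : ℕ} {ι : Type*} [Fintype ι]
    (P : ι → Fin k → (Fin d → ℝ)) : Measure (ι → (Fin d → ℝ)) :=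
  Measure.pi fun i => locationLaw (P i)

/-- `r(Q) = |Q ∩ r| / |Q|`, the fraction of the points of `Q` that lie in the range `r`. -/
noncomputable def rangeFraction {d : ℕ} {ι : Type*} [Fintype ι]
    (r : Set (Fin d → ℝ)) (Q : ι → (Fin d → ℝ)) : ℝ :=
  ({i : ι | Q i ∈ r}.ncard : ℝ) / (Fintype.card ι : ℝ)

/-- `E_{r(P)}`, the expectation of `r(Q)` over the random transversals `Q` of `P`. -/
noncomputable def rangeExpectation {d k : ℕ} {ι : Type*} [Fintype ι]
    (P : ι → Fin k → (Fin d → ℝ)) (r : Set (Fin d → ℝ)) : ℝ :=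
  ∫ Q, rangeFraction r Q ∂(transversalLaw P)

/-- The nonempty subset `T` of the uncertain points of `P` is an `ε`-RE coreset of `(P, 𝒜)`:
`|E_{r(P)} - E_{r(T)}| ≤ ε` for every range `r ∈ 𝒜`. -/
def IsRECoreset {d k : ℕ} {ι : Type*} [Fintype ι] (ε : ℝ)
    (P : ι → Fin k → (Fin d → ℝ)) (𝒜 : Set (Set (Fin d → ℝ))) (T : Finset ι) : Prop :=
  T.Nonempty ∧
    ∀ r ∈ 𝒜, |rangeExpectation P r - rangeExpectation (fun i : T => P i) r| ≤ ε

/-- The axis-aligned rectangles of `ℝ^d`: products of `d` intervals of the real line. The intervals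
may be open, closed, half-open, bounded or unbounded (order-connected subsets of `ℝ`). -/
def axisRectangles (d : ℕ) : Set (Set (Fin d → ℝ)) :=
  {r | ∃ I : Fin d → Set ℝ, (∀ j, (I j).OrdConnected) ∧ r = Set.univ.pi I}

end UncertainPoints

namespace UncertainPoints

/-! By linearity of expectation, `rangeExpectation P r` is the average over `i` of the fraction
`f_i(r)` of the locations of `P i` in `r` (`rangeExpectation_eq`). So it suffices to halve the
family repeatedly along colourings `χ = ±1` for which all sums `∑ χ_i f_i(r)` are small.

Such colourings come from a factorization. In rank coordinates an interval is a difference of two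
prefixes, and the prefix matrix on `2^h` ranks factors through vectors of squared norm at most `h`
(`exists_prefix_factorization`). Tensoring over the `d` axes writes `1[z ∈ r]` as `⟨Φ r, Ψ z⟩` with
`‖Φ‖ ‖Ψ‖ ≤ (2h)^d`. Averaging `Ψ` over the locations of a point does not increase the norm bound, so
`k` enters only through the number of ranks. The derandomized Gram-Schmidt walk
(`exists_coloring_sum_exp_le`) colours vectors of the unit ball with subgaussian sums, and a union
bound over the boxes of ranks gives discrepancy `O(h^(d+1/2))` when `|S| k < 2^h`.

The errors of successive halvings form a geometric series dominated by the last one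
(`exists_subset_of_discrepancy`). Stopping at `2^h` of order `(k/ε) log(k/ε)^(d+1/2)`, or at a
constant scale if that is larger, leaves `|T| k < 2^h`. Hence `|T| = O(ε⁻¹ log(k/ε)^(d+1/2))`, which
suffices because `d + 1/2 ≤ (3d-1)/2` for `d ≥ 2` and `√k ≥ 1`. -/

/-! ### Moment generating functions of two-valued variables. -/

theorem cosh_add_mul_sinh_pos {x : ℝ} (hx : |x| ≤ 1) (a : ℝ) :
    0 < Real.cosh a + x * Real.sinh a := by
  obtain ⟨h1, h2⟩ := abs_le.1 hx
  rw [Real.cosh_eq, Real.sinh_eq]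
  have e1 := Real.exp_pos a
  have e2 := Real.exp_pos (-a)
  nlinarith [mul_nonneg (by linarith : 0 ≤ 1 + x) e1.le, mul_nonneg (by linarith : 0 ≤ 1 - x) e2.le]

/-- The moment generating function at `a` of a centred variable taking the values `1 - x` and
`-1 - x`. -/
noncomputable def centredMGF (x a : ℝ) : ℝ :=
  (Real.cosh a + x * Real.sinh a) * Real.exp (-(a * x))

theorem centredMGF_neg (x a : ℝ) : centredMGF x (-a) = centredMGF (-x) a := by
  simp [centredMGF]

theorem centredMGF_zero (x : ℝ) : centredMGF x 0 = 1 := by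
  simp [centredMGF]

theorem centredMGF_pos {x : ℝ} (hx : |x| ≤ 1) (a : ℝ) : 0 < centredMGF x a :=
  mul_pos (cosh_add_mul_sinh_pos hx a) (Real.exp_pos _)

theorem monotoneOn_centredMGF {x : ℝ} (hx : |x| ≤ 1) :
    MonotoneOn (centredMGF x) (Set.Ici 0) := by
  have hd : ∀ a, HasDerivAt (centredMGF x)
      ((1 - x ^ 2) * Real.sinh a * Real.exp (-(a * x))) a := by
    intro a
    have h1 := ((Real.hasDerivAt_cosh a).add ((Real.hasDerivAt_sinh a).const_mul x)).mul
      (((hasDerivAt_id a).mul_const x).neg.exp)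
    refine HasDerivAt.congr_deriv h1 ?_
    simp only [id, Pi.add_apply, Pi.neg_apply]
    ring
  refine monotoneOn_of_deriv_nonneg (convex_Ici 0)
    (fun a _ => (hd a).continuousAt.continuousWithinAt)
    (fun a _ => (hd a).differentiableAt.differentiableWithinAt) ?_
  intro a ha
  rw [interior_Ici] at ha
  rw [(hd a).deriv]
  have : x ^ 2 ≤ 1 := (sq_le_one_iff_abs_le_one x).2 hx
  have h2 : 0 ≤ Real.sinh a := Real.sinh_nonneg_iff.2 (le_of_lt ha)
  have : 0 ≤ 1 - x ^ 2 := by linarith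
  positivity

/-- The logarithmic derivative `φ` of `cosh + x sinh` satisfies `φ(0) = x` and `φ' = 1 - φ² ≤ 1`, so
`φ(a) ≤ a + x`. This is the sign condition for the derivative in `antitoneOn_centredMGF_mul_exp`. -/
theorem one_sub_sq_mul_sinh_le {x : ℝ} (hx : |x| ≤ 1) {a : ℝ} (ha : 0 ≤ a) :
    (1 - x ^ 2) * Real.sinh a ≤ a * (Real.cosh a + x * Real.sinh a) := by
  have hg := cosh_add_mul_sinh_pos hx
  have hd : ∀ b, HasDerivAt
      (fun b => b - (Real.sinh b + x * Real.cosh b) / (Real.cosh b + x * Real.sinh b))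
      (((Real.sinh b + x * Real.cosh b) / (Real.cosh b + x * Real.sinh b)) ^ 2) b := by
    intro b
    have h1 := (hasDerivAt_id b).sub
      (((Real.hasDerivAt_sinh b).add ((Real.hasDerivAt_cosh b).const_mul x)).div
        ((Real.hasDerivAt_cosh b).add ((Real.hasDerivAt_sinh b).const_mul x)) (hg b).ne')
    refine HasDerivAt.congr_deriv h1 ?_
    have := (hg b).ne'
    simp only [Pi.add_apply]
    field_simp
    ring
  have hm : Monotone (fun b : ℝ =>
      b - (Real.sinh b + x * Real.cosh b) / (Real.cosh b + x * Real.sinh b)) :=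
    monotone_of_deriv_nonneg (fun b => (hd b).differentiableAt)
      (fun b => by rw [(hd b).deriv]; positivity)
  have h := hm ha
  simp only [Real.sinh_zero, Real.cosh_zero, mul_zero, add_zero, zero_add, mul_one, div_one,
    zero_sub] at h
  have h2 : (Real.sinh a + x * Real.cosh a) / (Real.cosh a + x * Real.sinh a) ≤ a + x := by
    linarith
  rw [div_le_iff₀ (hg a)] at h2
  nlinarith

/-- A monotone form of Hoeffding's lemma; the usual inequality is the comparison with `a = 0`. -/
theorem antitoneOn_centredMGF_mul_exp {x : ℝ} (hx : |x| ≤ 1) :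
    AntitoneOn (fun a => Real.exp (-(a ^ 2 / 2)) * centredMGF x a) (Set.Ici 0) := by
  have hd : ∀ a, HasDerivAt (fun a => Real.exp (-(a ^ 2 / 2)) * centredMGF x a)
      (((1 - x ^ 2) * Real.sinh a - a * (Real.cosh a + x * Real.sinh a)) *
        (Real.exp (-(a * x)) * Real.exp (-(a ^ 2 / 2)))) a := by
    intro a
    have h1 := ((((hasDerivAt_id a).pow 2).div_const 2).neg.exp).mul
      (((Real.hasDerivAt_cosh a).add ((Real.hasDerivAt_sinh a).const_mul x)).mul
      (((hasDerivAt_id a).mul_const x).neg.exp))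
    refine HasDerivAt.congr_deriv h1 ?_
    simp only [id, Pi.add_apply, Pi.neg_apply, Pi.mul_apply, Pi.pow_apply, Nat.cast_ofNat]
    ring
  refine antitoneOn_of_deriv_nonpos (convex_Ici 0)
    (fun a _ => (hd a).continuousAt.continuousWithinAt)
    (fun a _ => (hd a).differentiableAt.differentiableWithinAt) ?_
  intro a ha
  rw [interior_Ici] at ha
  rw [(hd a).deriv]
  have := one_sub_sq_mul_sinh_le hx (le_of_lt ha)
  exact mul_nonpos_of_nonpos_of_nonneg (by linarith) (by positivity)

theorem exp_mul_centredMGF_le_one {x : ℝ} (hx : |x| ≤ 1) (a : ℝ) :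
    Real.exp (-(a ^ 2 / 2)) * centredMGF x a ≤ 1 := by
  rcases le_total 0 a with ha | ha
  · simpa [centredMGF_zero] using
      antitoneOn_centredMGF_mul_exp hx Set.self_mem_Ici ha ha
  · have h := antitoneOn_centredMGF_mul_exp (x := -x) (by simpa using hx) Set.self_mem_Ici
      (Set.mem_Ici.2 (neg_nonneg.2 ha)) (neg_nonneg.2 ha)
    simpa [centredMGF_zero, centredMGF_neg] using h

theorem one_le_centredMGF {x : ℝ} (hx : |x| ≤ 1) (a : ℝ) : 1 ≤ centredMGF x a := by
  rcases le_total 0 a with ha | ha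
  · simpa [centredMGF_zero] using monotoneOn_centredMGF hx Set.self_mem_Ici ha ha
  · have h := monotoneOn_centredMGF (x := -x) (by simpa using hx) Set.self_mem_Ici
      (Set.mem_Ici.2 (neg_nonneg.2 ha)) (neg_nonneg.2 ha)
    simpa [centredMGF_zero, centredMGF_neg] using h

/-- The one-variable inequality behind freezing a non-pivot element: `a` and `a'` will be the inner
products of `θ` with the residuals before and after, and `D` the drop in the squared norm of the
projection of `θ`. -/
theorem exp_mul_centredMGF_le {x : ℝ} (hx : |x| ≤ 1) {a a' D s z : ℝ} (hs0 : 0 ≤ s) (hs1 : s ≤ 1)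
    (hD : 0 ≤ D) (ha : a = s * a' + z) (hz : z ^ 2 ≤ s * (1 - s) * D) :
    Real.exp (-(a' ^ 2 / 2)) * centredMGF x a' ≤
      Real.exp (D / 2) * (Real.exp (-(a ^ 2 / 2)) * centredMGF x a) := by
  wlog h0 : 0 ≤ a generalizing x a a' z
  · have := this (x := -x) (a := -a) (a' := -a') (z := -z) (by simpa using hx)
      (by rw [ha]; ring) (by simpa using hz) (by linarith)
    simpa [centredMGF_neg] using this
  have hzD : z ^ 2 ≤ D := by nlinarith [mul_nonneg hs0 (by linarith : 0 ≤ 1 - s), sq_nonneg s]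
  rcases lt_or_ge a' 0 with h1 | h1
  -- Here `s * a' ≤ 0`, so `0 ≤ a ≤ z`.
  · have h2 : a ^ 2 ≤ D := by
      have : a ≤ z := by nlinarith
      nlinarith
    calc _ ≤ 1 := exp_mul_centredMGF_le_one hx a'
      _ ≤ Real.exp (D / 2 + -(a ^ 2 / 2)) * centredMGF x a :=
        one_le_mul_of_one_le_of_one_le (Real.one_le_exp (by linarith)) (one_le_centredMGF hx a)
      _ = _ := by rw [Real.exp_add]; ring
  rcases le_total a' a with h2 | h2
  -- Convexity gives `(s a' + z)² ≤ s a'² + z² / (1 - s)`; the denominator is why `s = 1`, where `z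
  -- = 0`, is treated apart.
  · have h3 : a ^ 2 ≤ a' ^ 2 + D := by
      rcases hs1.eq_or_lt with rfl | hs
      · have : z = 0 := by
          have : z ^ 2 ≤ 0 := by simpa using hz
          exact pow_eq_zero_iff (two_ne_zero) |>.1 (le_antisymm this (sq_nonneg z))
        subst this
        nlinarith
      · have hp : 0 < 1 - s := by linarith
        have h6 : z ^ 2 ≤ (1 - s) * D := by
          nlinarith [mul_nonneg hp.le hD, mul_nonneg (mul_nonneg hp.le hD) hp.le]
        have h7 : 0 ≤ (1 - s) * (a' ^ 2 + D - a ^ 2) := by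
          rw [ha]
          nlinarith [mul_nonneg hs0 (sq_nonneg ((1 - s) * a' - z)),
            mul_nonneg (mul_nonneg hp.le hp.le) (sq_nonneg a')]
        linarith [nonneg_of_mul_nonneg_right h7 hp]
    have h4 := monotoneOn_centredMGF hx (Set.mem_Ici.2 h1) (Set.mem_Ici.2 h0) h2
    calc _ ≤ Real.exp (D / 2 + -(a ^ 2 / 2)) * centredMGF x a :=
        mul_le_mul (Real.exp_le_exp.2 (by linarith)) h4 (centredMGF_pos hx _).le
          (Real.exp_pos _).le
      _ = _ := by rw [Real.exp_add]; ring
  · have h4 := antitoneOn_centredMGF_mul_exp hx (Set.mem_Ici.2 h0) (Set.mem_Ici.2 h1) h2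
    refine h4.trans (le_mul_of_one_le_left ?_ (Real.one_le_exp (by linarith)))
    exact mul_nonneg (Real.exp_pos _).le (centredMGF_pos hx _).le

/-- From a point of the cube one can move along `±u` to the boundary. -/
theorem exists_move_to_boundary {ι : Type*} {A : Finset ι} {p : ι} (hp : p ∈ A) {u x : ι → ℝ}
    (hu : |u p| = 1) (hu0 : ∀ i ∉ A, u i = 0) (hx : ∀ i, |x i| ≤ 1) (s : ℝ) :
    ∃ δ : ℝ, δ * s ≤ 0 ∧ (∀ i, |x i + δ * u i| ≤ 1) ∧ ∃ i ∈ A, |x i + δ * u i| = 1 := by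
  wlog hs : s ≤ 0 generalizing u s
  · obtain ⟨δ, h1, h2, h3⟩ := this (u := fun i => -u i) (by simpa using hu)
      (fun i hi => by simp [hu0 i hi]) (-s) (by linarith)
    exact ⟨-δ, by linarith, fun i => by simpa using h2 i, by simpa using h3⟩
  have hA : A.Nonempty := ⟨p, hp⟩
  let f : ℝ → ℝ := fun δ => A.sup' hA fun i => |x i + δ * u i|
  have hf : Continuous f := by
    refine Continuous.finset_sup'_apply hA fun i _ => by fun_prop
  have h0 : f 0 ≤ 1 := Finset.sup'_le _ _ fun i _ => by simpa using hx i
  -- A step of length 2 carries the coordinate `p` from `[-1, 1]` out to absolute value at least 1.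
  have h2 : 1 ≤ f 2 := by
    refine le_trans ?_ (Finset.le_sup' (fun i => |x i + 2 * u i|) hp)
    have h3 := abs_sub_abs_le_abs_sub (2 * u p) (-x p)
    rw [abs_mul, hu, abs_neg] at h3
    norm_num at h3
    rw [add_comm]
    linarith [hx p]
  obtain ⟨δ, hδ, hfδ⟩ := intermediate_value_Icc (by norm_num : (0 : ℝ) ≤ 2) hf.continuousOn
    ⟨h0, h2⟩
  refine ⟨δ, mul_nonpos_of_nonneg_of_nonpos hδ.1 hs, fun i => ?_, ?_⟩
  · by_cases hi : i ∈ A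
    · rw [← hfδ]
      exact Finset.le_sup' (fun i => |x i + δ * u i|) hi
    · simpa [hu0 i hi] using hx i
  · obtain ⟨i, hi, h⟩ := Finset.exists_mem_eq_sup' hA fun i => |x i + δ * u i|
    exact ⟨i, hi, by rw [← h]; exact hfδ⟩

/-! ### Projections onto nested subspaces. -/

section Projection

variable {E : Type*} [NormedAddCommGroup E] [InnerProductSpace ℝ E]

theorem norm_sq_starProjection_sub {K L : Submodule ℝ E} [K.HasOrthogonalProjection]
    [L.HasOrthogonalProjection] (h : K ≤ L) (θ : E) :
    ‖L.starProjection θ - K.starProjection θ‖ ^ 2 =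
      ‖L.starProjection θ‖ ^ 2 - ‖K.starProjection θ‖ ^ 2 := by
  have h1 : inner ℝ (L.starProjection θ) (K.starProjection θ) = ‖K.starProjection θ‖ ^ 2 := by
    have h2 := L.starProjection_inner_eq_zero θ _ (h (K.starProjection_apply_mem θ))
    have h3 := K.starProjection_inner_eq_zero θ _ (K.starProjection_apply_mem θ)
    rw [inner_sub_left] at h2 h3
    rw [← real_inner_self_eq_norm_sq]
    linarith
  rw [norm_sub_sq_real, h1]
  ring

/-- Such a `z` sees only the component of `θ` in `L` orthogonal to `K`; apply Cauchy-Schwarz and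
Pythagoras. -/
theorem inner_sq_le_of_mem_orthogonal {K L : Submodule ℝ E} [K.HasOrthogonalProjection]
    [L.HasOrthogonalProjection] (h : K ≤ L) {z : E} (hzL : z ∈ L) (hzK : z ∈ Kᗮ) (θ : E) :
    inner ℝ z θ ^ 2 ≤ ‖z‖ ^ 2 * (‖L.starProjection θ‖ ^ 2 - ‖K.starProjection θ‖ ^ 2) := by
  have h1 : inner ℝ z θ = inner ℝ z (L.starProjection θ - K.starProjection θ) := by
    have h2 := L.starProjection_inner_eq_zero θ _ hzL
    have h3 := (Submodule.mem_orthogonal K z).1 hzK _ (K.starProjection_apply_mem θ)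
    rw [real_inner_comm, inner_sub_right] at h2
    rw [real_inner_comm] at h3
    rw [inner_sub_right]
    linarith
  rw [h1, ← norm_sq_starProjection_sub h, ← mul_pow, ← sq_abs]
  exact pow_le_pow_left₀ (abs_nonneg _) (abs_real_inner_le_norm _ _) 2

end Projection

/-! ### The Gram-Schmidt walk and its potential. -/

section GramSchmidtWalk

variable {E : Type*} [NormedAddCommGroup E] [InnerProductSpace ℝ E] {ι : Type*}

/-- The span of the vectors `v i`, `i ∈ B`. -/
def spanOn (v : ι → E) (B : Finset ι) : Submodule ℝ E := Submodule.span ℝ (v '' B)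

theorem spanOn_mono (v : ι → E) {B B' : Finset ι} (h : B ⊆ B') : spanOn v B ≤ spanOn v B' :=
  Submodule.span_mono (Set.image_mono (by exact_mod_cast h))

theorem mem_spanOn (v : ι → E) {B : Finset ι} {i : ι} (h : i ∈ B) : v i ∈ spanOn v B :=
  Submodule.subset_span ⟨i, h, rfl⟩

variable [FiniteDimensional ℝ E]

/-- The component of `v p` orthogonal to the vectors `v i`, `i ∈ B`. -/
noncomputable def residual (v : ι → E) (B : Finset ι) (p : ι) : E :=
  v p - (spanOn v B).starProjection (v p)

theorem residual_mem_orthogonal (v : ι → E) (B : Finset ι) (p : ι) :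
    residual v B p ∈ (spanOn v B)ᗮ :=
  Submodule.sub_starProjection_mem_orthogonal _

theorem norm_residual_le (v : ι → E) (hv : ∀ i, ‖v i‖ ≤ 1) (B : Finset ι) (p : ι) :
    ‖residual v B p‖ ^ 2 ≤ 1 := by
  have h1 := (spanOn v B).norm_sq_eq_add_norm_sq_starProjection (v p)
  rw [Submodule.starProjection_orthogonal_val] at h1
  have h2 : ‖v p‖ ^ 2 ≤ 1 := pow_le_one₀ (norm_nonneg _) (hv p)
  have h3 : ‖residual v B p‖ = ‖v p - (spanOn v B).starProjection (v p)‖ := rfl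
  rw [h3]
  nlinarith [sq_nonneg ‖(spanOn v B).starProjection (v p)‖]

variable [DecidableEq ι]

theorem residual_mem (v : ι → E) (B : Finset ι) (p : ι) :
    residual v B p ∈ spanOn v (insert p B) :=
  Submodule.sub_mem _ (mem_spanOn v (Finset.mem_insert_self p B))
    (spanOn_mono v (Finset.subset_insert p B) (Submodule.starProjection_apply_mem _ _))

/-- Supplies the direction of the walk: it moves only alive coordinates, the pivot at unit speed,
and shifts the vector sum along the residual. -/
theorem exists_residual_eq_sum [Fintype ι] (v : ι → E) {B : Finset ι} {p : ι} (hp : p ∉ B) :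
    ∃ u : ι → ℝ, u p = 1 ∧ (∀ i ∉ insert p B, u i = 0) ∧ ∑ i, u i • v i = residual v B p := by
  have h := (spanOn v B).starProjection_apply_mem (v p)
  obtain ⟨c, hc⟩ : ∃ c : ι → ℝ,
      ∑ i ∈ B, c i • v i = (spanOn v B).starProjection (v p) := by
    obtain ⟨c, hc⟩ := (Submodule.mem_span_image_finset_iff_exists_fun (R := ℝ)).1 h
    refine ⟨fun i => if h : i ∈ B then c ⟨i, h⟩ else 0, ?_⟩
    rw [← hc, ← Finset.sum_coe_sort]
    exact Finset.sum_congr rfl fun i _ => by simp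
  refine ⟨fun i => if i = p then 1 else if i ∈ B then -c i else 0, by simp, ?_, ?_⟩
  · intro i hi
    rw [Finset.mem_insert, not_or] at hi
    simp [hi.1, hi.2]
  · have h1 : ∀ i, (if i = p then (1 : ℝ) else if i ∈ B then -c i else 0) • v i =
        (if i = p then v i else 0) - (if i ∈ B then c i • v i else 0) := by
      intro i
      by_cases hi : i = p
      · subst hi; simp [hp]
      · by_cases hB : i ∈ B <;> simp [hi, hB]
    rw [Finset.sum_congr rfl fun i _ => h1 i, Finset.sum_sub_distrib]
    simp [residual, hc]

theorem inner_residual_sq_le (v : ι → E) (hv : ∀ i, ‖v i‖ ≤ 1) (B : Finset ι) (p : ι) (θ : E) :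
    inner ℝ (residual v B p) θ ^ 2 ≤ ‖(spanOn v (insert p B)).starProjection θ‖ ^ 2 -
      ‖(spanOn v B).starProjection θ‖ ^ 2 := by
  have hle := spanOn_mono v (Finset.subset_insert p B)
  refine (inner_sq_le_of_mem_orthogonal hle (residual_mem v B p)
    (residual_mem_orthogonal v B p) θ).trans ?_
  refine mul_le_of_le_one_left ?_ (norm_residual_le v hv B p)
  rw [← norm_sq_starProjection_sub hle]
  positivity

/-- The effect on the residual of enlarging the set of vectors that is projected away. -/
theorem exists_inner_residual_eq (v : ι → E) (hv : ∀ i, ‖v i‖ ≤ 1) {B B' : Finset ι}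
    (hB : B' ⊆ B) (p : ι) (θ : E) :
    ∃ s z : ℝ, 0 ≤ s ∧ s ≤ 1 ∧
      inner ℝ (residual v B p) θ = s * inner ℝ (residual v B' p) θ + z ∧
      z ^ 2 ≤ s * (1 - s) * (‖(spanOn v (insert p B)).starProjection θ‖ ^ 2 -
        ‖(spanOn v (insert p B')).starProjection θ‖ ^ 2) := by
  set w := residual v B p with hw
  set w' := residual v B' p with hw'
  have hins := Finset.insert_subset_insert p hB
  have hle := spanOn_mono v hins
  have hD : 0 ≤ ‖(spanOn v (insert p B)).starProjection θ‖ ^ 2 -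
        ‖(spanOn v (insert p B')).starProjection θ‖ ^ 2 := by
    rw [← norm_sq_starProjection_sub hle]; positivity
  have hdiff : w' - w ∈ spanOn v B := by
    have : w' - w = (spanOn v B).starProjection (v p) - (spanOn v B').starProjection (v p) := by
      simp [hw, hw', residual]
    rw [this]
    exact Submodule.sub_mem _ (Submodule.starProjection_apply_mem _ _)
      (spanOn_mono v hB (Submodule.starProjection_apply_mem _ _))
  have hww' : inner ℝ w w' = ‖w‖ ^ 2 := by
    have h := (Submodule.mem_orthogonal' _ _).1 (residual_mem_orthogonal v B p) _ hdiff
    rw [← hw, inner_sub_right, real_inner_self_eq_norm_sq] at h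
    linarith
  have hwle : ‖w‖ ≤ ‖w'‖ := by
    rcases (norm_nonneg w).eq_or_lt with h0 | h0
    · rw [← h0]; exact norm_nonneg _
    · have := real_inner_le_norm w w'
      rw [hww', sq] at this
      exact le_of_mul_le_mul_left this h0
  have hwo : w ∈ (spanOn v B')ᗮ :=
    Submodule.orthogonal_le (spanOn_mono v hB) (residual_mem_orthogonal v B p)
  have hwo' : w' ∈ (spanOn v B')ᗮ := residual_mem_orthogonal v B' p
  rcases eq_or_ne w' 0 with h0 | h0
  · have : w = 0 := by
      rw [h0, norm_zero] at hwle
      exact norm_le_zero_iff.1 hwle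
    exact ⟨0, 0, le_rfl, zero_le_one, by simp [this], by simp⟩
  have hn : 0 < ‖w'‖ ^ 2 := by positivity
  -- Since `⟨w, w'⟩ = ‖w‖²`, this `s` makes `s • w'` the projection of `w` onto the line of `w'`.
  -- The remainder is then orthogonal to `w'` and to `spanOn v B'`, hence to `v p` as well.
  set s := ‖w‖ ^ 2 / ‖w'‖ ^ 2 with hs
  have hs0 : 0 ≤ s := by positivity
  have hs1 : s ≤ 1 := div_le_one_of_le₀ (pow_le_pow_left₀ (norm_nonneg _) hwle 2) hn.le
  have hsw : s * ‖w'‖ ^ 2 = ‖w‖ ^ 2 := div_mul_cancel₀ _ hn.ne'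
  refine ⟨s, inner ℝ (w - s • w') θ, hs0, hs1, ?_, ?_⟩
  · rw [inner_sub_left, real_inner_smul_left]; ring
  have hz1 : w - s • w' ∈ spanOn v (insert p B) :=
    Submodule.sub_mem _ (residual_mem v B p) (Submodule.smul_mem _ _ (hle (residual_mem v B' p)))
  have hzo : inner ℝ (w - s • w') w' = 0 := by
    rw [inner_sub_left, real_inner_smul_left, hww', real_inner_self_eq_norm_sq, hsw, sub_self]
  have hz2 : w - s • w' ∈ (spanOn v (insert p B'))ᗮ := by
    have hB'o : w - s • w' ∈ (spanOn v B')ᗮ :=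
      Submodule.sub_mem _ hwo (Submodule.smul_mem _ _ hwo')
    have hsub : spanOn v (insert p B') ≤ (Submodule.span ℝ {w - s • w'})ᗮ := by
      refine Submodule.span_le.2 ?_
      rintro _ ⟨i, hi, rfl⟩
      rw [SetLike.mem_coe, Submodule.mem_orthogonal_singleton_iff_inner_right]
      rcases Finset.mem_insert.1 hi with rfl | hi
      · have : v i = w' + (spanOn v B').starProjection (v i) := by simp [hw', residual]
        rw [this, inner_add_right, hzo, zero_add]
        exact (Submodule.mem_orthogonal' _ _).1 hB'o _ (Submodule.starProjection_apply_mem _ _)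
      · exact (Submodule.mem_orthogonal' _ _).1 hB'o _ (mem_spanOn v hi)
    rw [Submodule.mem_orthogonal']
    intro y hy
    exact Submodule.mem_orthogonal_singleton_iff_inner_right.1 (hsub hy)
  have hz3 : ‖w - s • w'‖ ^ 2 ≤ s * (1 - s) := by
    have h1 : ‖w - s • w'‖ ^ 2 = ‖w‖ ^ 2 * (1 - s) := by
      rw [norm_sub_sq_real, real_inner_smul_right, hww', norm_smul, Real.norm_eq_abs, mul_pow,
        sq_abs, sq s, mul_assoc, hsw]
      ring
    have h2 : ‖w‖ ^ 2 ≤ s := by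
      rw [← hsw]
      exact mul_le_of_le_one_right hs0 (norm_residual_le v hv B' p)
    rw [h1]
    exact mul_le_mul_of_nonneg_right h2 (by linarith)
  exact (inner_sq_le_of_mem_orthogonal hle hz1 hz2 θ).trans (mul_le_mul_of_nonneg_right hz3 hD)

variable [Fintype ι]

/-- The potential of the Gram-Schmidt walk at the fractional colouring `x`, with pivot `p` and
other alive elements `B`, in the direction `θ`. -/
noncomputable def walkPotential (v : ι → E) (θ : E) (x : ι → ℝ) (B : Finset ι) (p : ι) : ℝ :=
  Real.exp (inner ℝ θ (∑ i, x i • v i) + ‖(spanOn v (insert p B)).starProjection θ‖ ^ 2 / 2) *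
    (Real.exp (-(inner ℝ (residual v B p) θ ^ 2 / 2)) *
      centredMGF (x p) (inner ℝ (residual v B p) θ))

theorem walkPotential_le (v : ι → E) (θ : E) {x : ι → ℝ} (hx : ∀ i, |x i| ≤ 1)
    (B : Finset ι) (p : ι) :
    walkPotential v θ x B p ≤ Real.exp (inner ℝ θ (∑ i, x i • v i) +
      ‖(spanOn v (insert p B)).starProjection θ‖ ^ 2 / 2) :=
  mul_le_of_le_one_right (Real.exp_pos _).le (exp_mul_centredMGF_le_one (hx p) _)

/-- The drop `D` of the squared projection norm contributes a factor `exp (-D/2)`, which exactly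
cancels the loss in `exp_mul_centredMGF_le`. -/
theorem walkPotential_erase_le (v : ι → E) (hv : ∀ i, ‖v i‖ ≤ 1) (θ : E) {x : ι → ℝ}
    (hx : ∀ i, |x i| ≤ 1) (B : Finset ι) (p q : ι) :
    walkPotential v θ x (B.erase q) p ≤ walkPotential v θ x B p := by
  have hB := Finset.erase_subset q B
  obtain ⟨s, z, hs0, hs1, ha, hz⟩ := exists_inner_residual_eq v hv hB p θ
  have hD : 0 ≤ ‖(spanOn v (insert p B)).starProjection θ‖ ^ 2 -
        ‖(spanOn v (insert p (B.erase q))).starProjection θ‖ ^ 2 := by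
    rw [← norm_sq_starProjection_sub (spanOn_mono v (Finset.insert_subset_insert p hB))]
    positivity
  have h := exp_mul_centredMGF_le (hx p) hs0 hs1 hD ha hz
  unfold walkPotential
  refine (mul_le_mul_of_nonneg_left h (Real.exp_pos _).le).trans_eq ?_
  rw [← mul_assoc, ← Real.exp_add]
  congr 2
  ring

/-- At `x p = ±1` the centred variable is constant, so its moment generating function is 1. The
Gaussian factor that remains is paid for by the decrease of the projection of `θ` when `p` leaves
the span. -/
theorem exp_le_walkPotential_of_abs_eq_one (v : ι → E) (hv : ∀ i, ‖v i‖ ≤ 1) (θ : E) {x : ι → ℝ}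
    (B : Finset ι) {p : ι} (hp : |x p| = 1) :
    Real.exp (inner ℝ θ (∑ i, x i • v i) + ‖(spanOn v B).starProjection θ‖ ^ 2 / 2) ≤
      walkPotential v θ x B p := by
  have h := inner_residual_sq_le v hv B p θ
  have h2 : centredMGF (x p) (inner ℝ (residual v B p) θ) = 1 := by
    unfold centredMGF
    rcases eq_or_eq_neg_of_abs_eq hp with h | h
    · rw [h, one_mul, Real.cosh_add_sinh, ← Real.exp_add]; simp
    · rw [h, neg_one_mul, ← sub_eq_add_neg, Real.cosh_sub_sinh, ← Real.exp_add]; simp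
  unfold walkPotential
  rw [h2, mul_one, ← Real.exp_add]
  exact Real.exp_le_exp.2 (by linarith)

/-- The factor `exp (a δ)` from the moving vector sum cancels the centring factor of `centredMGF`,
leaving `cosh a + (x p + δ) sinh a`. The potential is thus affine in `δ`, so for any finite sum of
potentials one sign of `δ` causes no increase; this replaces the random choice of sign. -/
theorem walkPotential_move (v : ι → E) (θ : E) (x : ι → ℝ) (B : Finset ι) (p : ι) {u : ι → ℝ}
    (hup : u p = 1) (hu : ∑ i, u i • v i = residual v B p) :
    ∃ s : ℝ, ∀ δ : ℝ, walkPotential v θ (fun i => x i + δ * u i) B p =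
      walkPotential v θ x B p + δ * s := by
  set a := inner ℝ (residual v B p) θ with ha
  refine ⟨Real.exp (inner ℝ θ (∑ i, x i • v i) +
    ‖(spanOn v (insert p B)).starProjection θ‖ ^ 2 / 2) * (Real.exp (-(a ^ 2 / 2)) *
      (Real.sinh a * Real.exp (-(a * x p)))), fun δ => ?_⟩
  have h1 : ∑ i, (x i + δ * u i) • v i = ∑ i, x i • v i + δ • residual v B p := by
    rw [← hu, Finset.smul_sum, ← Finset.sum_add_distrib]
    exact Finset.sum_congr rfl fun i _ => by rw [add_smul, mul_smul]
  have h2 : Real.exp (inner ℝ θ (∑ i, (x i + δ * u i) • v i) +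
      ‖(spanOn v (insert p B)).starProjection θ‖ ^ 2 / 2) =
      Real.exp (inner ℝ θ (∑ i, x i • v i) +
        ‖(spanOn v (insert p B)).starProjection θ‖ ^ 2 / 2) * Real.exp (a * δ) := by
    rw [h1, inner_add_right, real_inner_smul_right, real_inner_comm (residual v B p) θ, ← ha,
      ← Real.exp_add]
    ring_nf
  have h3 : Real.exp (-(a * (x p + δ))) = Real.exp (-(a * x p)) * (Real.exp (a * δ))⁻¹ := by
    rw [← Real.exp_neg, ← Real.exp_add]; ring_nf
  have h4 := (Real.exp_pos (a * δ)).ne'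
  simp only [walkPotential, h2, centredMGF, hup, mul_one, ← ha, h3]
  field_simp
  ring

/-- Each round moves along the residual direction, without increasing the total potential, until
some alive coordinate `q` reaches `±1`, and then freezes `q`. If `q` is the pivot, an arbitrary `r ∈
B` succeeds it; otherwise `q` is erased from `B`. Either way `B` loses one element. -/
theorem exists_coloring_le_walkPotential {τ : Type*} [Fintype τ] (v : ι → E)
    (hv : ∀ i, ‖v i‖ ≤ 1) (θ : τ → E) (m : ℕ) :
    ∀ (B : Finset ι) (p : ι) (x : ι → ℝ), B.card = m → p ∉ B → (∀ i, |x i| ≤ 1) →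
      (∀ i ∉ insert p B, |x i| = 1) → ∃ χ : ι → ℝ, (∀ i, |χ i| = 1) ∧
        ∑ t, Real.exp (inner ℝ (θ t) (∑ i, χ i • v i)) ≤ ∑ t, walkPotential v (θ t) x B p := by
  induction m with
  | zero =>
    intro B p x hB hp hx hx1
    obtain rfl := Finset.card_eq_zero.1 hB
    obtain ⟨u, hup, hu0, hu⟩ := exists_residual_eq_sum v hp
    choose s hs using fun t => walkPotential_move v (θ t) x ∅ p hup hu
    obtain ⟨δ, hδ, hδx, q, hq, hqδ⟩ := exists_move_to_boundary (Finset.mem_insert_self p ∅)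
      (by rw [hup, abs_one]) hu0 hx (∑ t, s t)
    obtain rfl : q = p := by simpa using hq
    refine ⟨fun i => x i + δ * u i, fun i => ?_, ?_⟩
    · by_cases hi : i = q
      · rw [hi]; exact hqδ
      · simp only [hu0 i (by simpa using hi), mul_zero, add_zero]
        exact hx1 i (by simpa using hi)
    · calc _ ≤ ∑ t, walkPotential v (θ t) (fun i => x i + δ * u i) ∅ q := by
            refine Finset.sum_le_sum fun t _ => le_trans ?_
              (exp_le_walkPotential_of_abs_eq_one v hv (θ t) ∅ hqδ)
            exact Real.exp_le_exp.2 (le_add_of_nonneg_right (by positivity))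
        _ ≤ _ := by
            simp only [hs, Finset.sum_add_distrib, ← Finset.mul_sum]
            linarith
  | succ m ih =>
    intro B p x hB hp hx hx1
    obtain ⟨u, hup, hu0, hu⟩ := exists_residual_eq_sum v hp
    choose s hs using fun t => walkPotential_move v (θ t) x B p hup hu
    obtain ⟨δ, hδ, hδx, q, hq, hqδ⟩ := exists_move_to_boundary (Finset.mem_insert_self p B)
      (by rw [hup, abs_one]) hu0 hx (∑ t, s t)
    have hle : ∑ t, walkPotential v (θ t) (fun i => x i + δ * u i) B p ≤
        ∑ t, walkPotential v (θ t) x B p := by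
      simp only [hs, Finset.sum_add_distrib, ← Finset.mul_sum]
      linarith
    have hout : ∀ i, i ∉ insert p B → |x i + δ * u i| = 1 := fun i hi => by
      rw [hu0 i hi, mul_zero, add_zero]
      exact hx1 i hi
    by_cases hqp : q = p
    · subst hqp
      obtain ⟨r, hr⟩ : B.Nonempty := Finset.card_pos.1 (by omega)
      obtain ⟨χ, hχ, hχle⟩ := ih (B.erase r) r (fun i => x i + δ * u i)
        (by rw [Finset.card_erase_of_mem hr, hB]; rfl) (Finset.notMem_erase r B) hδx
        (fun i hi => by
          rw [Finset.insert_erase hr] at hi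
          by_cases hiq : i = q
          · rw [hiq]; exact hqδ
          · exact hout i (by simp [hiq, hi]))
      refine ⟨χ, hχ, hχle.trans (le_trans (Finset.sum_le_sum fun t _ => ?_) hle)⟩
      refine le_trans ?_ (exp_le_walkPotential_of_abs_eq_one v hv (θ t) B hqδ)
      have := walkPotential_le v (θ t) hδx (B.erase r) r
      rwa [Finset.insert_erase hr] at this
    · have hqB : q ∈ B := (Finset.mem_insert.1 hq).resolve_left hqp
      obtain ⟨χ, hχ, hχle⟩ := ih (B.erase q) p (fun i => x i + δ * u i)
        (by rw [Finset.card_erase_of_mem hqB, hB]; rfl)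
        (fun h => hp (Finset.mem_of_mem_erase h)) hδx
        (fun i hi => by
          by_cases hiq : i = q
          · rw [hiq]; exact hqδ
          · refine hout i fun h => hi ?_
            rcases Finset.mem_insert.1 h with h | h
            · simp [h]
            · simp [h, hiq])
      exact ⟨χ, hχ, hχle.trans (le_trans (Finset.sum_le_sum fun t _ =>
        walkPotential_erase_le v hv (θ t) hδx B p q) hle)⟩

/-- Subgaussian colouring of vectors in the unit ball (the Gram-Schmidt walk, derandomized). -/
theorem exists_coloring_sum_exp_le {τ : Type*} [Fintype τ] (v : ι → E) (hv : ∀ i, ‖v i‖ ≤ 1)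
    (θ : τ → E) :
    ∃ χ : ι → ℝ, (∀ i, |χ i| = 1) ∧
      ∑ t, Real.exp (inner ℝ (θ t) (∑ i, χ i • v i)) ≤ ∑ t, Real.exp (‖θ t‖ ^ 2 / 2) := by
  rcases isEmpty_or_nonempty ι with h | ⟨⟨p⟩⟩
  · refine ⟨fun _ => 1, fun i => by simp, Finset.sum_le_sum fun t _ => Real.exp_le_exp.2 ?_⟩
    simp only [Finset.univ_eq_empty, Finset.sum_empty, inner_zero_right]
    positivity
  obtain ⟨χ, hχ, h⟩ := exists_coloring_le_walkPotential v hv θ _ (Finset.univ.erase p) p 0 rfl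
    (Finset.notMem_erase p _) (by simp) (by simp [Finset.insert_erase])
  refine ⟨χ, hχ, h.trans (Finset.sum_le_sum fun t _ =>
    (walkPotential_le v (θ t) (by simp) _ p).trans (Real.exp_le_exp.2 ?_))⟩
  simp only [Pi.zero_apply, zero_smul, Finset.sum_const_zero, inner_zero_right, zero_add]
  have := Submodule.norm_starProjection_apply_le
    (spanOn v (insert p (Finset.univ.erase p))) (θ t)
  gcongr

end GramSchmidtWalk

/-! ### From factorizations to discrepancy. -/

/-- A matrix with a factorization through unit columns and rows of norm at most `ρ` has
discrepancy at most `ρ √(2 log (2 |τ|))`. -/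
theorem exists_coloring_abs_sum_inner_le {E ι τ : Type*} [NormedAddCommGroup E]
    [InnerProductSpace ℝ E] [FiniteDimensional ℝ E] [Fintype ι] [Fintype τ] [Nonempty τ]
    (v : ι → E) (hv : ∀ i, ‖v i‖ ≤ 1) (θ : τ → E) {ρ : ℝ} (hρ : 0 < ρ) (hθ : ∀ t, ‖θ t‖ ≤ ρ) :
    ∃ χ : ι → ℝ, (∀ i, |χ i| = 1) ∧ ∀ t, |∑ i, χ i * inner ℝ (θ t) (v i)| ≤
      ρ * Real.sqrt (2 * Real.log (2 * Fintype.card τ)) := by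
  classical
  set N : ℝ := 2 * Fintype.card τ with hN
  have hN2 : 2 ≤ N := by
    have : (1 : ℝ) ≤ Fintype.card τ := by exact_mod_cast Fintype.card_pos
    linarith
  set ℓ := Real.sqrt (2 * Real.log N) with hℓ
  have hlog : 0 < Real.log N := Real.log_pos (by linarith)
  have hℓpos : 0 < ℓ := Real.sqrt_pos.2 (by positivity)
  have hℓsq : ℓ ^ 2 = 2 * Real.log N := Real.sq_sqrt (by positivity)
  -- Both signs are included to control absolute values. The scale `ℓ / ρ` balances the Chernoff
  -- bound: `N * exp (ℓ²/2) = exp (ℓ²)`.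
  obtain ⟨χ, hχ, h⟩ := exists_coloring_sum_exp_le v hv
    (Sum.elim (fun t => (ℓ / ρ) • θ t) (fun t => -((ℓ / ρ) • θ t)) : τ ⊕ τ → E)
  refine ⟨χ, hχ, fun t => ?_⟩
  have hexp : ∑ t : τ ⊕ τ, Real.exp (‖(Sum.elim (fun t => (ℓ / ρ) • θ t)
      (fun t => -((ℓ / ρ) • θ t)) : τ ⊕ τ → E) t‖ ^ 2 / 2) ≤ Real.exp (ℓ ^ 2) := by
    have hb : ∀ t, ‖(ℓ / ρ) • θ t‖ ^ 2 / 2 ≤ ℓ ^ 2 / 2 := fun t => by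
      rw [norm_smul, Real.norm_eq_abs, abs_of_pos (by positivity)]
      have : ℓ / ρ * ‖θ t‖ ≤ ℓ := by
        rw [div_mul_eq_mul_div, div_le_iff₀ hρ]
        exact mul_le_mul_of_nonneg_left (hθ t) hℓpos.le
      gcongr
    calc _ ≤ ∑ t : τ ⊕ τ, Real.exp (ℓ ^ 2 / 2) := by
          refine Finset.sum_le_sum fun t _ => Real.exp_le_exp.2 ?_
          rcases t with t | t
          · exact hb t
          · simpa using hb t
      _ = Real.exp (Real.log N) * Real.exp (ℓ ^ 2 / 2) := by
          rw [Real.exp_log (by linarith)]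
          simp [hN]
          ring
      _ = Real.exp (ℓ ^ 2) := by rw [← Real.exp_add]; congr 1; rw [hℓsq]; ring
  have hone : ∀ t', inner ℝ ((Sum.elim (fun t => (ℓ / ρ) • θ t)
      (fun t => -((ℓ / ρ) • θ t)) : τ ⊕ τ → E) t') (∑ i, χ i • v i) ≤ ℓ ^ 2 := fun t' =>
    Real.exp_le_exp.1 (((Finset.single_le_sum (fun t _ => (Real.exp_pos _).le)
      (Finset.mem_univ t')).trans h).trans hexp)
  have hsum : inner ℝ (θ t) (∑ i, χ i • v i) = ∑ i, χ i * inner ℝ (θ t) (v i) := by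
    rw [inner_sum]
    exact Finset.sum_congr rfl fun i _ => real_inner_smul_right _ _ _
  have h1 := hone (Sum.inl t)
  have h2 := hone (Sum.inr t)
  simp only [Sum.elim_inl, Sum.elim_inr, inner_neg_left, real_inner_smul_left, hsum] at h1 h2
  have h3 : ℓ / ρ * |∑ i, χ i * inner ℝ (θ t) (v i)| ≤ ℓ ^ 2 := by
    rw [← abs_of_pos (show 0 < ℓ / ρ by positivity), ← abs_mul]
    exact abs_le.2 ⟨by linarith, h1⟩
  rw [div_mul_eq_mul_div, div_le_iff₀ hρ, sq, mul_assoc] at h3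
  rw [mul_comm]
  exact le_of_mul_le_mul_left h3 hℓpos

/-- The dyadic factorization of the matrix `(s, t) ↦ 1[t < s]`. -/
theorem exists_prefix_factorization (h : ℕ) :
    ∃ (κ : Type) (_ : Fintype κ) (φ ψ : ℕ → κ → ℝ), (∀ s, ∑ c, φ s c ^ 2 ≤ h) ∧
      (∀ t, ∑ c, ψ t c ^ 2 ≤ h) ∧ ∀ s t, s < 2 ^ h → t < 2 ^ h →
        ∑ c, φ s c * ψ t c = if t < s then 1 else 0 := by
  induction h with
  | zero =>
    refine ⟨Empty, inferInstance, fun _ _ => 0, fun _ _ => 0, by simp, by simp, ?_⟩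
    intro s t hs ht
    have : ¬ t < s := by simp at hs ht; omega
    simp [this]
  | succ h ih =>
    obtain ⟨κ, _, φ, ψ, hφ, hψ, hφψ⟩ := ih
    -- The two halves of the range use separate copies of the previous factorization. The single new
    -- coordinate handles `t` in the lower half and `s` in the upper half, so each squared norm
    -- grows by at most 1.
    refine ⟨κ ⊕ κ ⊕ Unit, inferInstance,
      fun s => Sum.elim (fun c => if s < 2 ^ h then φ s c else 0)
        (Sum.elim (fun c => if s < 2 ^ h then 0 else φ (s - 2 ^ h) c)
          fun _ => if s < 2 ^ h then 0 else 1),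
      fun t => Sum.elim (fun c => if t < 2 ^ h then ψ t c else 0)
        (Sum.elim (fun c => if t < 2 ^ h then 0 else ψ (t - 2 ^ h) c)
          fun _ => if t < 2 ^ h then 1 else 0), ?_, ?_, ?_⟩
    · intro s
      by_cases hs : s < 2 ^ h
      · simpa [hs] using (hφ s).trans (by linarith)
      · simpa [hs] using hφ (s - 2 ^ h)
    · intro t
      by_cases ht : t < 2 ^ h
      · simpa [ht] using hψ t
      · simpa [ht] using (hψ (t - 2 ^ h)).trans (by linarith)
    · intro s t hs ht
      rw [pow_succ] at hs ht
      by_cases hs' : s < 2 ^ h <;> by_cases ht' : t < 2 ^ h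
      · simpa [hs', ht'] using hφψ s t hs' ht'
      · have : ¬ t < s := by omega
        simp [hs', ht', this]
      · have : t < s := by omega
        simp [hs', ht', this]
      · have h1 := hφψ (s - 2 ^ h) (t - 2 ^ h) (by omega) (by omega)
        have h2 : t - 2 ^ h < s - 2 ^ h ↔ t < s := by omega
        simpa [hs', ht', h2] using h1

/-- Ranks turn order-connected sets of reals into intervals of natural numbers. -/
theorem exists_rank {V : Finset ℝ} {N : ℕ} (hV : V.card < N) :
    ∃ f : ℝ → ℕ, (∀ z, f z < N) ∧ ∀ I : Set ℝ, I.OrdConnected →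
      ∃ a b : Fin N, a ≤ b ∧ ∀ z ∈ V, z ∈ I ↔ (a : ℕ) ≤ f z ∧ f z < b := by
  classical
  set f : ℝ → ℕ := fun z => (V.filter (· < z)).card with hf
  have hmono : Monotone f := fun x y hxy => Finset.card_le_card fun z hz => by
    simp only [Finset.mem_filter] at hz ⊢
    exact ⟨hz.1, hz.2.trans_le hxy⟩
  have hstrict : ∀ x ∈ V, ∀ y, x < y → f x < f y := fun x hx y hxy => by
    refine Finset.card_lt_card (Finset.ssubset_iff_of_subset ?_ |>.2 ⟨x, ?_, ?_⟩)
    · intro z hz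
      simp only [Finset.mem_filter] at hz ⊢
      exact ⟨hz.1, hz.2.trans hxy⟩
    · simp [hx, hxy]
    · simp
  refine ⟨f, fun z => (Finset.card_filter_le _ _).trans_lt hV, fun I hI => ?_⟩
  rcases (V.filter (· ∈ I)).eq_empty_or_nonempty with h0 | h0
  · refine ⟨⟨0, by omega⟩, ⟨0, by omega⟩, le_rfl, fun z hz => ?_⟩
    have : z ∉ I := fun hzI => by
      have : z ∈ V.filter (· ∈ I) := by simp [hz, hzI]
      simp [h0] at this
    simp [this]
  · set m := (V.filter (· ∈ I)).min' h0
    set M := (V.filter (· ∈ I)).max' h0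
    have hm := Finset.mem_filter.1 ((V.filter (· ∈ I)).min'_mem h0)
    have hM := Finset.mem_filter.1 ((V.filter (· ∈ I)).max'_mem h0)
    have hmM : m ≤ M := Finset.min'_le_max' _ h0
    -- `M` itself is not counted by `f M`, so `f M < V.card`, which leaves room for the exclusive
    -- upper end `f M + 1`.
    have hMN : f M + 1 < N := by
      refine lt_of_le_of_lt (Nat.succ_le_of_lt ?_) hV
      refine Finset.card_lt_card (Finset.ssubset_iff_of_subset (Finset.filter_subset _ _) |>.2
        ⟨M, hM.1, by simp⟩)
    refine ⟨⟨f m, (Finset.card_filter_le _ _).trans_lt hV⟩, ⟨f M + 1, hMN⟩, ?_, fun z hz => ?_⟩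
    · exact Fin.mk_le_mk.2 ((hmono hmM).trans (Nat.le_succ _))
    · simp only [Nat.lt_succ_iff]
      constructor
      · intro hzI
        have hz' : z ∈ V.filter (· ∈ I) := by simp [hz, hzI]
        exact ⟨hmono (Finset.min'_le _ _ hz'), hmono (Finset.le_max' _ _ hz')⟩
      · rintro ⟨h1, h2⟩
        refine hI.out hm.2 hM.2 ⟨?_, ?_⟩
        · by_contra! hlt
          exact absurd (hstrict z hz _ hlt) (not_lt.2 h1)
        · by_contra! hlt
          exact absurd (hstrict _ hM.1 _ hlt) (not_lt.2 h2)

/-! ### Discrepancy of axis-aligned rectangles. -/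

/-- The fraction of the locations of an uncertain point that lie in `r`. -/
noncomputable def locationFraction {d k : ℕ} (p : Fin k → (Fin d → ℝ))
    (r : Set (Fin d → ℝ)) : ℝ :=
  ({j | p j ∈ r}.ncard : ℝ) / k

theorem locationFraction_eq_sum {d k : ℕ} (p : Fin k → (Fin d → ℝ)) (r : Set (Fin d → ℝ)) :
    locationFraction p r = (k : ℝ)⁻¹ * ∑ j, r.indicator 1 (p j) := by
  classical
  rw [locationFraction, div_eq_inv_mul, Set.ncard_eq_toFinset_card']
  congr 1
  simp [Set.indicator_apply]

/-- The tensor product of the vectors `a 0, …, a (d - 1)`. -/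
noncomputable def tensorVector {d : ℕ} {κ : Type} [Fintype κ] (a : Fin d → κ → ℝ) :
    EuclideanSpace ℝ (Fin d → κ) :=
  WithLp.toLp 2 fun g => ∏ j, a j (g j)

theorem inner_tensorVector {d : ℕ} {κ : Type} [Fintype κ] (a b : Fin d → κ → ℝ) :
    inner ℝ (tensorVector a) (tensorVector b) = ∏ j, ∑ c, a j c * b j c := by
  classical
  rw [PiLp.inner_apply, Finset.prod_univ_sum, Fintype.piFinset_univ]
  refine Finset.sum_congr rfl fun g _ => ?_
  simp [tensorVector, Finset.prod_mul_distrib, mul_comm]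

theorem norm_sq_tensorVector_le {d : ℕ} {κ : Type} [Fintype κ] (a : Fin d → κ → ℝ) {B : ℝ}
    (h : ∀ j, ∑ c, a j c ^ 2 ≤ B) : ‖tensorVector a‖ ^ 2 ≤ B ^ d := by
  rw [← real_inner_self_eq_norm_sq, inner_tensorVector]
  calc _ ≤ ∏ _j : Fin d, B := Finset.prod_le_prod
        (fun j _ => Finset.sum_nonneg fun c _ => mul_self_nonneg _)
        (fun j _ => by simpa only [sq] using h j)
    _ = _ := by simp

/-- Colouring uncertain points with low discrepancy for axis-aligned rectangles. -/
theorem exists_coloring_rectangles {ι : Type*} [Fintype ι] {d k h : ℕ} (hk : 0 < k) (hh : 0 < h)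
    (P : ι → Fin k → (Fin d → ℝ)) (hcard : Fintype.card ι * k < 2 ^ h) :
    ∃ χ : ι → ℝ, (∀ i, |χ i| = 1) ∧ ∀ r ∈ axisRectangles d,
      |∑ i, χ i * locationFraction (P i) r| ≤
        (2 * h) ^ d * Real.sqrt (2 * Real.log (2 * ((2 ^ h * 2 ^ h) ^ d : ℕ))) := by
  classical
  obtain ⟨κ, _, φ, ψ, hφ, hψ, hφψ⟩ := exists_prefix_factorization h
  have hhR : (0 : ℝ) < h := by exact_mod_cast hh
  have hkR : (0 : ℝ) < k := by exact_mod_cast hk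
  let V : Fin d → Finset ℝ := fun j => Finset.univ.image fun q : ι × Fin k => P q.1 q.2 j
  have hV : ∀ j, (V j).card < 2 ^ h := fun j =>
    (Finset.card_image_le.trans_eq (by simp)).trans_lt hcard
  choose f hf hfI using fun j => exists_rank (hV j)
  set R : ℝ := Real.sqrt h ^ d with hR
  have hRpos : 0 < R := by positivity
  have hR2 : R ^ 2 = (h : ℝ) ^ d := by
    rw [hR, ← pow_mul, mul_comm, pow_mul, Real.sq_sqrt hhR.le]
  let Ψ : (Fin d → ℝ) → EuclideanSpace ℝ (Fin d → κ) := fun z =>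
    tensorVector fun j => ψ (f j (z j))
  -- On each axis, the rank interval `[a, b)` is the prefix of `b` minus the prefix of `a`.
  -- Subtraction costs a factor 4 in the squared norm, hence the `2` in `(2 * h) ^ d`.
  let Φ : (Fin d → Fin (2 ^ h) × Fin (2 ^ h)) → EuclideanSpace ℝ (Fin d → κ) := fun t =>
    tensorVector fun j c => φ (t j).2 c - φ (t j).1 c
  let v : ι → EuclideanSpace ℝ (Fin d → κ) := fun i => (R⁻¹ * (k : ℝ)⁻¹) • ∑ l, Ψ (P i l)
  have hΨ : ∀ z, ‖Ψ z‖ ≤ R := fun z => by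
    refine le_of_sq_le_sq ?_ hRpos.le
    rw [hR2]
    exact norm_sq_tensorVector_le _ fun j => hψ _
  have hΦ : ∀ t, ‖R • Φ t‖ ≤ (2 * h) ^ d := fun t => by
    refine le_of_sq_le_sq ?_ (by positivity)
    rw [norm_smul, mul_pow, Real.norm_eq_abs, sq_abs, hR2]
    have h1 : ‖Φ t‖ ^ 2 ≤ (4 * h : ℝ) ^ d := by
      refine norm_sq_tensorVector_le _ fun j => ?_
      calc _ ≤ ∑ c, (2 * φ (t j).2 c ^ 2 + 2 * φ (t j).1 c ^ 2) :=
            Finset.sum_le_sum fun c _ => by nlinarith [sq_nonneg (φ (t j).2 c + φ (t j).1 c)]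
        _ ≤ _ := by
            rw [Finset.sum_add_distrib, ← Finset.mul_sum, ← Finset.mul_sum]
            linarith [hφ (t j).1, hφ (t j).2]
    calc _ ≤ (h : ℝ) ^ d * (4 * h) ^ d := by gcongr
      _ = _ := by rw [← mul_pow, ← pow_mul, mul_comm d 2, pow_mul]; ring
  have hv : ∀ i, ‖v i‖ ≤ 1 := fun i => by
    have h1 : ‖∑ l, Ψ (P i l)‖ ≤ k * R := by
      refine (norm_sum_le_of_le _ fun l _ => hΨ (P i l)).trans_eq (by simp)
    rw [norm_smul, Real.norm_eq_abs, abs_of_pos (by positivity)]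
    calc _ ≤ R⁻¹ * (k : ℝ)⁻¹ * (k * R) := by gcongr
      _ = 1 := by field_simp
  have hne : Nonempty (Fin d → Fin (2 ^ h) × Fin (2 ^ h)) :=
    ⟨fun _ => (⟨0, by positivity⟩, ⟨0, by positivity⟩)⟩
  obtain ⟨χ, hχ, hdisc⟩ := exists_coloring_abs_sum_inner_le v hv (fun t => R • Φ t)
    (show (0 : ℝ) < (2 * h) ^ d by positivity) hΦ
  refine ⟨χ, hχ, ?_⟩
  rintro r ⟨I, hI, rfl⟩
  choose a b hab habI using fun j => hfI j (I j) (hI j)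
  have h1 : ∀ i l, inner ℝ (Φ fun j => (a j, b j)) (Ψ (P i l)) =
      (Set.univ.pi I).indicator (1 : (Fin d → ℝ) → ℝ) (P i l) := by
    intro i l
    have h2 : ∀ j, ∑ c, (φ (b j) c - φ (a j) c) * ψ (f j (P i l j)) c =
        if P i l j ∈ I j then 1 else 0 := fun j => by
      have h3 := habI j (P i l j) (Finset.mem_image.2 ⟨(i, l), Finset.mem_univ _, rfl⟩)
      have h4 : (a j : ℕ) ≤ b j := hab j
      simp only [sub_mul, Finset.sum_sub_distrib, hφψ _ _ (b j).2 (hf j _),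
        hφψ _ _ (a j).2 (hf j _), h3]
      split_ifs <;> first | omega | norm_num
    simp only [Φ, Ψ, inner_tensorVector, h2, Set.indicator_apply, Set.mem_univ_pi, Pi.one_apply]
    rw [Finset.prod_ite_zero]
    simp
  have h5 : ∀ i, inner ℝ (R • Φ fun j => (a j, b j)) (v i) =
      locationFraction (P i) (Set.univ.pi I) := fun i => by
    rw [locationFraction_eq_sum, real_inner_smul_left, real_inner_smul_right, inner_sum,
      Finset.sum_congr rfl fun l _ => h1 i l]
    field_simp
  have h6 := hdisc fun j => (a j, b j)
  simp only [h5] at h6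
  refine h6.trans_eq ?_
  simp

/-! ### Expectations as averages of location fractions. -/

theorem measurableSet_of_mem_axisRectangles {d : ℕ} {r : Set (Fin d → ℝ)}
    (hr : r ∈ axisRectangles d) : MeasurableSet r := by
  obtain ⟨I, hI, rfl⟩ := hr
  exact MeasurableSet.univ_pi fun j => (hI j).measurableSet

theorem isProbabilityMeasure_locationLaw {d k : ℕ} (hk : 0 < k) (p : Fin k → (Fin d → ℝ)) :
    IsProbabilityMeasure (locationLaw p) := by
  have : Nonempty (Fin k) := ⟨⟨0, hk⟩⟩
  have : IsProbabilityMeasure (uniformOn (Set.univ : Set (Fin k))) :=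
    isProbabilityMeasure_uniformOn Set.finite_univ Set.univ_nonempty
  exact Measure.isProbabilityMeasure_map (measurable_of_finite p).aemeasurable

theorem locationLaw_real {d k : ℕ} (p : Fin k → (Fin d → ℝ)) {r : Set (Fin d → ℝ)}
    (hr : MeasurableSet r) : (locationLaw p).real r = locationFraction p r := by
  classical
  rw [locationLaw, map_measureReal_apply (measurable_of_finite p) hr, Measure.real,
    uniformOn_univ, locationFraction, Measure.count_apply (Set.toFinite _).measurableSet,
    ENNReal.toReal_div]
  congr 1
  · rw [← (Set.toFinite (p ⁻¹' r)).cast_ncard_eq, ENat.toENNReal_coe, ENNReal.toReal_natCast]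
    rfl
  · simp

/-- Linearity of expectation: only the marginals of the transversal law matter. -/
theorem rangeExpectation_eq {d k : ℕ} {ι : Type*} [Fintype ι] (hk : 0 < k)
    (P : ι → Fin k → (Fin d → ℝ)) {r : Set (Fin d → ℝ)} (hr : MeasurableSet r) :
    rangeExpectation P r = (∑ i, locationFraction (P i) r) / Fintype.card ι := by
  classical
  have := fun i => isProbabilityMeasure_locationLaw hk (P i)
  have h1 : ∀ Q : ι → (Fin d → ℝ), rangeFraction r Q =
      (∑ i, r.indicator (1 : (Fin d → ℝ) → ℝ) (Q i)) / Fintype.card ι := fun Q => by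
    rw [rangeFraction, Set.ncard_eq_toFinset_card']
    simp [Set.indicator_apply]
  have hmeas : Measurable (r.indicator (1 : (Fin d → ℝ) → ℝ)) := measurable_one.indicator hr
  have hint : ∀ i, Integrable (r.indicator (1 : (Fin d → ℝ) → ℝ)) (locationLaw (P i)) := fun i =>
    (integrable_const (1 : ℝ)).indicator hr
  have hmp : ∀ i, MeasurePreserving (Function.eval i) (transversalLaw P) (locationLaw (P i)) :=
    fun i => measurePreserving_eval _ i
  simp only [rangeExpectation, h1, integral_div]
  congr 1
  have hint' : ∀ i, Integrable (fun Q : ι → (Fin d → ℝ) =>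
      r.indicator (1 : (Fin d → ℝ) → ℝ) (Q i)) (transversalLaw P) := fun i =>
    ((hmp i).integrable_comp (hint i).aestronglyMeasurable).2 (hint i)
  rw [integral_finsetSum _ fun i _ => hint' i]
  refine Finset.sum_congr rfl fun i _ => ?_
  have h2 : ∫ Q, r.indicator (1 : (Fin d → ℝ) → ℝ) (Q i) ∂(transversalLaw P) =
      ∫ q, r.indicator 1 q ∂(locationLaw (P i)) := by
    rw [← (hmp i).map_eq, integral_map (hmp i).measurable.aemeasurable
      hmeas.aestronglyMeasurable]
  rw [h2, integral_indicator_one hr, locationLaw_real (P i) hr]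

/-! ### Halving. -/

/-- Keeping the smaller colour class of a low-discrepancy colouring changes averages little. -/
theorem exists_half_subset {ι : Type*} {S : Finset ι} {F : Set (ι → ℝ)}
    (hF : ∀ f ∈ F, ∀ i, 0 ≤ f i ∧ f i ≤ 1) (hF1 : 1 ∈ F) {χ : ι → ℝ} (hχ : ∀ i, |χ i| = 1) {Δ : ℝ}
    (hdisc : ∀ f ∈ F, |∑ i ∈ S, χ i * f i| ≤ Δ) (hΔ : Δ < S.card) :
    ∃ T ⊆ S, T.Nonempty ∧ 2 * T.card ≤ S.card ∧
      ∀ f ∈ F, |(∑ i ∈ S, f i) / S.card - (∑ i ∈ T, f i) / T.card| ≤ 2 * Δ / S.card := by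
  classical
  wlog hneg : ∑ i ∈ S, χ i ≤ 0 generalizing χ
  · refine this (χ := fun i => -χ i) (fun i => by simpa using hχ i) (fun f hf => ?_) ?_
    · simpa [Finset.sum_neg_distrib] using hdisc f hf
    · rw [Finset.sum_neg_distrib]; linarith
  set T := S.filter fun i => χ i = 1 with hT
  have hsum : ∀ f : ι → ℝ, 2 * ∑ i ∈ T, f i = ∑ i ∈ S, f i + ∑ i ∈ S, χ i * f i := fun f => by
    rw [hT, Finset.sum_filter, Finset.mul_sum, ← Finset.sum_add_distrib]
    refine Finset.sum_congr rfl fun i _ => ?_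
    rcases eq_or_eq_neg_of_abs_eq (hχ i) with h | h
    · simp [h]; ring
    · rw [h]; norm_num
  have hcard : 2 * (T.card : ℝ) = S.card + ∑ i ∈ S, χ i := by simpa using hsum 1
  -- The constant function in `F` makes the two classes nearly equal in size; with `Δ < S.card` it
  -- also makes `T` nonempty.
  have h1 : |∑ i ∈ S, χ i| ≤ Δ := by simpa using hdisc 1 hF1
  have hTpos : (0 : ℝ) < T.card := by linarith [(abs_le.1 h1).1]
  have hSpos : (0 : ℝ) < S.card := by linarith
  refine ⟨T, Finset.filter_subset _ _, Finset.card_pos.1 (by exact_mod_cast hTpos), ?_, ?_⟩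
  · have : 2 * (T.card : ℝ) ≤ S.card := by linarith
    exact_mod_cast this
  intro f hf
  have hfT0 : 0 ≤ ∑ i ∈ T, f i := Finset.sum_nonneg fun i _ => (hF f hf i).1
  have hfT1 : ∑ i ∈ T, f i ≤ T.card :=
    (Finset.sum_le_card_nsmul T f 1 fun i _ => (hF f hf i).2).trans_eq (by simp)
  have key : (∑ i ∈ S, f i) / S.card - (∑ i ∈ T, f i) / T.card =
      ((∑ i ∈ T, f i) / T.card * ∑ i ∈ S, χ i - ∑ i ∈ S, χ i * f i) / S.card := by
    have e1 : ∑ i ∈ S, χ i = 2 * T.card - S.card := by linarith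
    have e2 : ∑ i ∈ S, χ i * f i = 2 * ∑ i ∈ T, f i - ∑ i ∈ S, f i := by linarith [hsum f]
    have e3 := hSpos.ne'
    have e4 := hTpos.ne'
    rw [e1, e2]
    generalize (S.card : ℝ) = m at e3 ⊢
    generalize (T.card : ℝ) = m' at e4 ⊢
    field_simp
    ring
  rw [key, abs_div, abs_of_pos hSpos]
  refine div_le_div_of_nonneg_right ?_ hSpos.le
  refine (abs_sub _ _).trans ?_
  rw [abs_mul, abs_of_nonneg (div_nonneg hfT0 hTpos.le)]
  have h2 : (∑ i ∈ T, f i) / T.card * |∑ i ∈ S, χ i| ≤ |∑ i ∈ S, χ i| :=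
    mul_le_of_le_one_left (abs_nonneg _) (div_le_one_of_le₀ hfT1 hTpos.le)
  linarith [hdisc f hf]

/-- Repeated halving. -/
theorem exists_subset_of_discrepancy {ι : Type*} {F : Set (ι → ℝ)}
    (hF : ∀ f ∈ F, ∀ i, 0 ≤ f i ∧ f i ≤ 1) (hF1 : 1 ∈ F) {k h₀ : ℕ} (hk : 0 < k) {Δ : ℕ → ℝ}
    (hΔ : ∀ h, 0 ≤ Δ h) (hratio : ∀ h, h₀ ≤ h → 2 * Δ (h + 1) ≤ 3 * Δ h)
    (hsmall : 12 * Δ h₀ * k ≤ 2 ^ h₀)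
    (hdisc : ∀ h, h₀ ≤ h → ∀ S : Finset ι, S.card * k < 2 ^ h →
      ∃ χ : ι → ℝ, (∀ i, |χ i| = 1) ∧ ∀ f ∈ F, |∑ i ∈ S, χ i * f i| ≤ Δ h)
    {h : ℕ} (hh : h₀ ≤ h) : ∀ S : Finset ι, S.Nonempty → S.card * k < 2 ^ h →
      ∃ T : Finset ι, T.Nonempty ∧ T.card * k < 2 ^ h₀ ∧
        ∀ f ∈ F, |(∑ i ∈ S, f i) / S.card - (∑ i ∈ T, f i) / T.card| ≤
          12 * (Δ h₀ * k / 2 ^ h₀ - Δ h * k / 2 ^ h) := by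
  have hkR : (0 : ℝ) < k := by exact_mod_cast hk
  -- Put `b h = Δ h * k / 2 ^ h`; then `b (h + 1) ≤ (3/4) b h`. A halving at level `h + 1` costs at
  -- most `4 b (h + 1)`, which is at most `12 (b h - b (h + 1))`, so the total telescopes; this is
  -- the origin of the 12.
  have hstep : ∀ h, h₀ ≤ h → 4 * (Δ (h + 1) * k / 2 ^ (h + 1)) ≤ 3 * (Δ h * k / 2 ^ h) := by
    intro h hh
    have e : 4 * (Δ (h + 1) * k / 2 ^ (h + 1)) = (2 * Δ (h + 1)) * (k / 2 ^ h) := by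
      rw [pow_succ]; field_simp; ring
    have e2 : 3 * (Δ h * k / 2 ^ h) = (3 * Δ h) * (k / 2 ^ h) := by ring
    rw [e, e2]
    exact mul_le_mul_of_nonneg_right (hratio h hh) (by positivity)
  have hb0 : ∀ h, 0 ≤ Δ h * k / 2 ^ h := fun h => by
    have := hΔ h
    positivity
  have hanti : ∀ h, h₀ ≤ h → Δ h * k / 2 ^ h ≤ Δ h₀ * k / 2 ^ h₀ := by
    intro h hh
    induction h, hh using Nat.le_induction with
    | base => exact le_rfl
    | succ h hh ih => linarith [hstep h hh, hb0 (h + 1)]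
  have hsmall' : Δ h₀ * k / 2 ^ h₀ ≤ 1 / 12 := by
    rw [div_le_iff₀ (by positivity)]
    linarith
  induction h, hh using Nat.le_induction with
  | base => exact fun S hS hSk => ⟨S, hS, hSk, fun f _ => by simp⟩
  | succ h hh ih =>
    intro S hS hSk
    have hst := hstep h hh
    rcases lt_or_ge (S.card * k) (2 ^ h) with hlt | hge
    · obtain ⟨T, hT, hTk, hTf⟩ := ih S hS hlt
      exact ⟨T, hT, hTk, fun f hf => (hTf f hf).trans (by linarith [hb0 (h + 1)])⟩
    · have hSpos : (0 : ℝ) < S.card := by exact_mod_cast hS.card_pos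
      have hge' : (2 : ℝ) ^ h ≤ S.card * k := by exact_mod_cast hge
      obtain ⟨χ, hχ, hd⟩ := hdisc (h + 1) (by omega) S hSk
      have e : 2 * (Δ (h + 1) / 2 ^ h * k) = 4 * (Δ (h + 1) * k / 2 ^ (h + 1)) := by
        rw [pow_succ]; field_simp; ring
      have hdiv : Δ (h + 1) / S.card ≤ Δ (h + 1) / 2 ^ h * k := by
        rw [div_le_iff₀ hSpos, mul_assoc, div_mul_eq_mul_div, le_div_iff₀ (by positivity)]
        rw [mul_comm (k : ℝ)]
        exact mul_le_mul_of_nonneg_left hge' (hΔ _)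
      have hlt : Δ (h + 1) < S.card := by
        rw [← div_lt_one hSpos]
        linarith [hanti h hh]
      obtain ⟨S', _, hS'n, hS'c, hS'f⟩ := exists_half_subset hF hF1 hχ hd hlt
      have hS'k : S'.card * k < 2 ^ h := by
        have : 2 * S'.card * k ≤ S.card * k := Nat.mul_le_mul_right k hS'c
        rw [pow_succ] at hSk
        rw [mul_assoc] at this
        omega
      obtain ⟨T, hT, hTk, hTf⟩ := ih S' hS'n hS'k
      refine ⟨T, hT, hTk, fun f hf => (abs_sub_le _ ((∑ i ∈ S', f i) / S'.card) _).trans ?_⟩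
      have h1 := hS'f f hf
      rw [mul_div_assoc] at h1
      linarith [hTf f hf]

/-! ### Growth estimates and the stopping scale. -/

open Filter Topology in
theorem eventually_two_mul_add_one_rpow_le (a : ℝ) :
    ∀ᶠ h : ℕ in atTop, 2 * ((h + 1 : ℕ) : ℝ) ^ a ≤ 3 * (h : ℝ) ^ a := by
  have h1 : Tendsto (fun h : ℕ => (1 + 1 / (h : ℝ)) ^ a) atTop (𝓝 1) := by
    have h2 : Tendsto (fun h : ℕ => 1 + 1 / (h : ℝ)) atTop (𝓝 1) := by
      simpa using tendsto_one_div_atTop_nhds_zero_nat.const_add (1 : ℝ)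
    simpa using h2.rpow_const (p := a) (Or.inl one_ne_zero)
  filter_upwards [h1.eventually_le_const (show (1 : ℝ) < 3 / 2 by norm_num),
    eventually_gt_atTop 0] with h hh hpos
  have hR : (0 : ℝ) < h := by exact_mod_cast hpos
  have e : ((h + 1 : ℕ) : ℝ) = h * (1 + 1 / h) := by push_cast; field_simp
  rw [e, Real.mul_rpow hR.le (by positivity)]
  have := Real.rpow_nonneg hR.le a
  nlinarith

open Filter Topology in
theorem exists_rpow_le_mul_exp (a c : ℝ) {b : ℝ} (hb : 0 < b) :
    ∃ B : ℝ, 1 ≤ B ∧ ∀ h : ℕ, c * (h : ℝ) ^ a ≤ B * Real.exp (b * h) := by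
  have h1 : Tendsto (fun h : ℕ => c * ((h : ℝ) ^ a / Real.exp (b * h))) atTop (𝓝 (c * 0)) :=
    (((isLittleO_rpow_exp_pos_mul_atTop a hb).tendsto_div_nhds_zero).comp
      tendsto_natCast_atTop_atTop).const_mul c
  obtain ⟨B, hB⟩ := h1.bddAbove_range
  refine ⟨max B 1, le_max_right _ _, fun h => ?_⟩
  have h2 : c * ((h : ℝ) ^ a / Real.exp (b * h)) ≤ max B 1 := (hB ⟨h, rfl⟩).trans (le_max_left _ _)
  rwa [← mul_div_assoc, div_le_iff₀ (Real.exp_pos _)] at h2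

/-- The scale at which halving stops: `2 ^ h` is about `x (log x) ^ a`. -/
theorem exists_stopping_scale (a c : ℝ) (ha : 0 < a) (hc : 0 < c) (m : ℕ) :
    ∃ A : ℝ, 0 < A ∧ ∀ x : ℝ, 2 ≤ x → ∃ h : ℕ, m ≤ h ∧ c * (h : ℝ) ^ a * x ≤ 2 ^ h ∧
      (h = m ∨ (2 : ℝ) ^ h ≤ A * Real.log x ^ a * x) := by
  have hl2 : 0 < Real.log 2 := Real.log_pos (by norm_num)
  obtain ⟨B, hB1, hB⟩ := exists_rpow_le_mul_exp a c (b := Real.log 2 / 2) (by positivity)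
  have hpow : ∀ h : ℕ, (2 : ℝ) ^ h = Real.exp (Real.log 2 / 2 * h) ^ 2 := fun h => by
    rw [← Real.exp_nat_mul, ← Real.rpow_natCast, Real.rpow_def_of_pos (by norm_num)]
    congr 1
    push_cast
    ring
  have hlB : 0 ≤ Real.log B := Real.log_nonneg hB1
  set D := 2 / Real.log 2 * (Real.log B / Real.log 2 + 1) with hD
  have hDpos : 0 < D := by positivity
  refine ⟨2 * c * D ^ a, by positivity, fun x hx => ?_⟩
  have hx0 : 0 < x := by linarith
  have hlx : Real.log 2 ≤ Real.log x := Real.log_le_log (by norm_num) hx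
  have hex : ∃ h : ℕ, m ≤ h ∧ c * (h : ℝ) ^ a * x ≤ 2 ^ h := by
    have ht : Filter.Tendsto (fun h : ℕ => Real.exp (Real.log 2 / 2 * h)) Filter.atTop
        Filter.atTop := Real.tendsto_exp_atTop.comp
      (tendsto_natCast_atTop_atTop.const_mul_atTop (by positivity))
    obtain ⟨h, hh1, hh2⟩ := ((ht.eventually_ge_atTop (B * x)).and
      (Filter.eventually_ge_atTop m)).exists
    refine ⟨h, hh2, ?_⟩
    rw [hpow, sq]
    calc _ ≤ B * Real.exp (Real.log 2 / 2 * h) * x := mul_le_mul_of_nonneg_right (hB h) hx0.le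
      _ = B * x * Real.exp (Real.log 2 / 2 * h) := by ring
      _ ≤ _ := by gcongr
  -- Take the least admissible `h`. If it exceeds `m`, its predecessor fails the inequality. Since
  -- `c h^a ≤ B 2^(h/2)`, that failure bounds the predecessor by `D log x`, and reinserting this
  -- bound in the failed inequality gives the claim.
  classical
  refine ⟨Nat.find hex, (Nat.find_spec hex).1, (Nat.find_spec hex).2, ?_⟩
  rcases (Nat.find_spec hex).1.eq_or_lt with heq | hlt
  · exact Or.inl heq.symm
  right
  obtain ⟨h, hh⟩ : ∃ h, Nat.find hex = h + 1 := ⟨Nat.find hex - 1, by omega⟩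
  have hmin := Nat.find_min hex (m := h) (by omega)
  rw [not_and, not_le] at hmin
  have hmin := hmin (by omega)
  rw [hh, pow_succ]
  have h1 : Real.exp (Real.log 2 / 2 * h) < B * x := by
    rw [hpow, sq] at hmin
    have : Real.exp (Real.log 2 / 2 * h) * Real.exp (Real.log 2 / 2 * h) <
        B * x * Real.exp (Real.log 2 / 2 * h) := by
      refine hmin.trans_le ?_
      calc _ ≤ B * Real.exp (Real.log 2 / 2 * h) * x := mul_le_mul_of_nonneg_right (hB h) hx0.le
        _ = _ := by ring
    exact lt_of_mul_lt_mul_right this (Real.exp_pos _).le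
  have h2 : (h : ℝ) ≤ D * Real.log x := by
    have h3 := (Real.lt_log_iff_exp_lt (by positivity)).2 h1
    rw [Real.log_mul (by linarith) hx0.ne'] at h3
    have h4 : Real.log B ≤ Real.log B / Real.log 2 * Real.log x := by
      rw [div_mul_eq_mul_div, le_div_iff₀ hl2]
      gcongr
    have h5 : (h : ℝ) = 2 / Real.log 2 * (Real.log 2 / 2 * h) := by field_simp
    rw [h5, hD, mul_assoc]
    exact mul_le_mul_of_nonneg_left (by linarith) (by positivity)
  calc (2 : ℝ) ^ h * 2 ≤ c * (h : ℝ) ^ a * x * 2 := by gcongr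
    _ ≤ c * (D * Real.log x) ^ a * x * 2 := by gcongr
    _ = _ := by rw [Real.mul_rpow hDpos.le (hl2.le.trans hlx)]; ring

theorem locationFraction_nonneg {d k : ℕ} (p : Fin k → (Fin d → ℝ)) (r : Set (Fin d → ℝ)) :
    0 ≤ locationFraction p r := by
  unfold locationFraction
  positivity

theorem locationFraction_le_one {d k : ℕ} (p : Fin k → (Fin d → ℝ)) (r : Set (Fin d → ℝ)) :
    locationFraction p r ≤ 1 := by
  refine div_le_one_of_le₀ ?_ (Nat.cast_nonneg k)
  have := Set.ncard_le_card {j | p j ∈ r}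
  simp at this
  exact_mod_cast this

theorem locationFraction_univ {d k : ℕ} (hk : 0 < k) (p : Fin k → (Fin d → ℝ)) :
    locationFraction p Set.univ = 1 := by
  have : (k : ℝ) ≠ 0 := by exact_mod_cast hk.ne'
  simp [locationFraction, Set.ncard_univ, this]

/-- The discrepancy bound of `exists_coloring_rectangles` for subfamilies, in power form. -/
theorem exists_coloring_rectangles_subset {ι : Type*} {d k h : ℕ} (hd : 0 < d) (hk : 0 < k)
    (hh : 0 < h) (P : ι → Fin k → (Fin d → ℝ)) (S : Finset ι) (hS : S.card * k < 2 ^ h) :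
    ∃ χ : ι → ℝ, (∀ i, |χ i| = 1) ∧ ∀ r ∈ axisRectangles d,
      |∑ i ∈ S, χ i * locationFraction (P i) r| ≤
        2 ^ d * Real.sqrt (6 * d) * (h : ℝ) ^ ((d : ℝ) + 1 / 2) := by
  classical
  obtain ⟨χ, hχ, h1⟩ := exists_coloring_rectangles hk hh (fun i : S => P i) (by simpa using hS)
  have hhR : (1 : ℝ) ≤ h := by exact_mod_cast hh
  have hdR : (1 : ℝ) ≤ d := by exact_mod_cast hd
  refine ⟨fun i => if h : i ∈ S then χ ⟨i, h⟩ else 1, fun i => ?_, fun r hr => ?_⟩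
  · dsimp only
    split_ifs with hi
    · exact hχ _
    · simp
  · rw [← Finset.sum_coe_sort]
    simp only [Finset.coe_mem, dite_true, Subtype.coe_eta]
    refine (h1 r hr).trans ?_
    have h2 : Real.log (2 * ((2 ^ h * 2 ^ h) ^ d : ℕ)) ≤ 3 * (d * h) := by
      have e : (2 * ((2 ^ h * 2 ^ h) ^ d : ℕ) : ℝ) = 2 ^ (1 + 2 * (h * d)) := by
        push_cast
        rw [← pow_add, ← pow_mul, ← pow_succ']
        congr 1
        ring
      rw [e, Real.log_pow]
      have h3 : Real.log 2 ≤ 1 := by linarith [Real.log_two_lt_d9]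
      have h4 : (1 : ℝ) ≤ d * h := one_le_mul_of_one_le_of_one_le hdR hhR
      calc _ ≤ ((1 + 2 * (h * d) : ℕ) : ℝ) * 1 := by gcongr
        _ ≤ _ := by push_cast; linarith
    calc _ ≤ (2 * (h : ℝ)) ^ d * Real.sqrt (6 * d * h) := by
          refine mul_le_mul_of_nonneg_left (Real.sqrt_le_sqrt ?_) (by positivity)
          linarith
      _ = _ := by
          rw [Real.sqrt_mul (by positivity) (h : ℝ), Real.rpow_add (by linarith),
            Real.rpow_natCast, ← Real.sqrt_eq_rpow, mul_pow]
          ring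

end UncertainPoints

/-! ### Assembly. -/

theorem mainTheorem3 (d : ℕ) (hd : 1 < d) :
    ∃ C : ℝ, 0 < C ∧
      ∀ (k : ℕ) (ε : ℝ), 0 < ε → ε ≤ 1 → 2 ≤ (k : ℝ) / ε →
        ∀ (n : ℕ), 0 < n → ∀ P : Fin n → Fin k → (Fin d → ℝ),
          ∃ T : Finset (Fin n),
            UncertainPoints.IsRECoreset ε P (UncertainPoints.axisRectangles d) T ∧
              (T.card : ℝ) ≤
                C * (Real.sqrt k / ε) * Real.log ((k : ℝ) / ε) ^ ((3 * (d : ℝ) - 1) / 2) := by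
  open UncertainPoints in
  have hdR : (2 : ℝ) ≤ d := by exact_mod_cast hd
  set a : ℝ := (d : ℝ) + 1 / 2 with ha
  set e : ℝ := (3 * (d : ℝ) - 1) / 2 with he
  have ha0 : 0 < a := by positivity
  have hae : a ≤ e := by rw [ha, he]; linarith
  set c : ℝ := 2 ^ d * Real.sqrt (6 * d) with hc
  have hc0 : 0 < c := by positivity
  obtain ⟨m, hm⟩ := Filter.eventually_atTop.1 (eventually_two_mul_add_one_rpow_le a)
  -- The factor 12 is that of the total halving error. The lower limit `max m 1` secures both the
  -- growth condition on `Δ` and the positivity of `h` needed for colouring.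
  obtain ⟨A, hA, hscale⟩ := exists_stopping_scale a (12 * c) ha0 (by positivity) (max m 1)
  have hl2 : 0 < Real.log 2 := Real.log_pos (by norm_num)
  -- One summand for each outcome of `hscale`: stopping at the minimal scale, where `|T|` is bounded
  -- by a constant, and stopping at the scale `A L^a k / ε`. The powers of `log 2` absorb the change
  -- to exponent `e`, since `L` may be below 1.
  refine ⟨2 ^ max m 1 / Real.log 2 ^ e + A * Real.log 2 ^ (a - e), by positivity, ?_⟩
  intro k ε hε hε1 hkε n hn P
  have hk : 0 < k := by
    rcases Nat.eq_zero_or_pos k with rfl | h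
    · norm_num at hkε
    · exact h
  have hkR : (1 : ℝ) ≤ k := by exact_mod_cast hk
  obtain ⟨h₀, hmh, hh₀, hor⟩ := hscale _ hkε
  set L := Real.log ((k : ℝ) / ε) with hL
  have hL2 : Real.log 2 ≤ L := Real.log_le_log (by norm_num) hkε
  have hL0 : 0 < L := hl2.trans_le hL2
  have hh₀1 : 1 ≤ h₀ := (le_max_right _ _).trans hmh
  have hn' : (Finset.univ : Finset (Fin n)).Nonempty := ⟨⟨0, hn⟩, Finset.mem_univ _⟩
  have hΔ : ∀ h : ℕ, 0 ≤ c * (h : ℝ) ^ a := fun h => by positivity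
  have hsmall : 12 * (c * (h₀ : ℝ) ^ a) * k ≤ ε * 2 ^ h₀ := by
    rw [← mul_div_assoc, div_le_iff₀ hε] at hh₀
    linarith
  obtain ⟨T, hT, hTk, hTf⟩ := exists_subset_of_discrepancy
    (F := {f | ∃ r ∈ axisRectangles d, f = fun i => locationFraction (P i) r})
    (by rintro _ ⟨r, -, rfl⟩ i
        exact ⟨locationFraction_nonneg _ _, locationFraction_le_one _ _⟩)
    ⟨Set.univ, ⟨fun _ => Set.univ, fun _ => Set.ordConnected_univ, by simp⟩,
      by funext i; exact (locationFraction_univ hk _).symm⟩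
    hk hΔ
    (fun h hh => by
      have := hm h ((le_max_left _ _).trans (hmh.trans hh))
      nlinarith)
    (hsmall.trans (mul_le_of_le_one_left (by positivity) hε1))
    (fun h hh S hS => by
      obtain ⟨χ, hχ, h1⟩ := exists_coloring_rectangles_subset (by omega) hk (by omega) P S hS
      refine ⟨χ, hχ, ?_⟩
      rintro _ ⟨r, hr, rfl⟩
      exact h1 r hr)
    -- Any starting level with `n * k < 2 ^ h` would do, as the error bound does not depend on the
    -- number of halvings.
    (Nat.le_add_right h₀ (n * k)) Finset.univ hn'
    (by
      rw [Finset.card_univ, Fintype.card_fin]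
      exact Nat.lt_two_pow_self.trans_le (Nat.pow_le_pow_right (by norm_num) (by omega)))
  refine ⟨T, ⟨hT, fun r hr => ?_⟩, ?_⟩
  · have hr' := measurableSet_of_mem_axisRectangles hr
    rw [rangeExpectation_eq hk _ hr', rangeExpectation_eq hk _ hr',
      Finset.sum_coe_sort T fun i => locationFraction (P i) r, Fintype.card_coe]
    refine (hTf _ ⟨r, hr, rfl⟩).trans ?_
    have h1 : 0 ≤ c * ((h₀ + n * k : ℕ) : ℝ) ^ a * k / 2 ^ (h₀ + n * k) := by positivity
    have h2 : 12 * (c * (h₀ : ℝ) ^ a * k / 2 ^ h₀) ≤ ε := by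
      rw [← mul_div_assoc, div_le_iff₀ (by positivity), ← mul_assoc]
      exact hsmall
    linarith
  · have hTk' : (T.card : ℝ) * k ≤ 2 ^ h₀ := by exact_mod_cast hTk.le
    have hsq : 1 ≤ Real.sqrt k := Real.one_le_sqrt.2 hkR
    have hsqε : 1 ≤ Real.sqrt k / ε := by
      rw [le_div_iff₀ hε]; linarith
    have hLe : Real.log 2 ^ e ≤ L ^ e := Real.rpow_le_rpow hl2.le hL2 (ha0.le.trans hae)
    have hpos : 0 < Real.log 2 ^ e := by positivity
    rcases hor with heq | hle
    · calc (T.card : ℝ) ≤ T.card * k := le_mul_of_one_le_right (by positivity) hkR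
        _ ≤ 2 ^ max m 1 := by rw [← heq]; exact hTk'
        _ = 2 ^ max m 1 / Real.log 2 ^ e * 1 * Real.log 2 ^ e := by field_simp
        _ ≤ (2 ^ max m 1 / Real.log 2 ^ e + A * Real.log 2 ^ (a - e)) *
            (Real.sqrt k / ε) * L ^ e := by
          gcongr
          exact le_add_of_nonneg_right (by positivity)
    · have h1 : (T.card : ℝ) ≤ A * L ^ a * (1 / ε) := by
        have : (T.card : ℝ) * k ≤ A * L ^ a * (1 / ε) * k := by
          refine (hTk'.trans hle).trans_eq ?_
          ring
        exact le_of_mul_le_mul_right this (by linarith)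
      have h2 : L ^ a ≤ Real.log 2 ^ (a - e) * L ^ e := by
        calc L ^ a = L ^ (a - e) * L ^ e := by rw [← Real.rpow_add hL0]; congr 1; ring
          _ ≤ _ := mul_le_mul_of_nonneg_right
            (Real.rpow_le_rpow_of_nonpos hl2 hL2 (by linarith)) (by positivity)
      calc (T.card : ℝ) ≤ A * L ^ a * (1 / ε) := h1
        _ ≤ A * (Real.log 2 ^ (a - e) * L ^ e) * (Real.sqrt k / ε) := by gcongr
        _ = (A * Real.log 2 ^ (a - e)) * (Real.sqrt k / ε) * L ^ e := by ring
        _ ≤ _ := by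
          gcongr
          exact le_add_of_nonneg_left (by positivity)
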